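/- **Setting.** For a compact set $C\subset\mathbb R$ with at least two points, its gaps are the bounded connected components of $\mathbb R\setminus C$. Remove them from the convex hull of $C$ in order of decreasing length (gaps of equal length from left to right). When a gap $G$ is removed, it lies in a connected component (a closed interval) of what is left of the hull, and $G$ splits this interval into a left piece $L_G$ and a right piece $R_G$. The thickness of $C$ is $\tau(C)=\inf_G \min\{|L_G|,|R_G|\}/|G|\in[0,\infty]$; it is $+\infty$ for a non-degenerate interval, and $\tau=0$ for a singleton. A function $f:\mathbb R\to\mathbb R$ is bi-Lipschitz with constants $(c_1,c_2)$, $c_1>0$, if $c_1|x-y|\le|f(x)-f(y)|\le c_2|x-y|$ for all $x,y\in\mathbb R$. A set $E\subset\mathbb{R}$ contains the pattern $(f_i)_{i\in\Lambda}$ if there is $t\in\mathbb R$ with $f_i(t)\in E$ for all $i\in\Lambda$. **Theorem.** Let $A\ge 1$, $D>0$, $m>0$, put $\beta=\min\{\frac mD,\frac1{4A}\}$ and $$N(\tau)=\left\lfloor\frac{\tau\beta}{720^2\,e\,A^{1-\frac1{\log(\tau\beta)}}}\Bigl(1-\beta^{\frac1{\log(\tau\beta)}}\Bigr)\right\rfloor\quad(e/\beta\le\tau<\infty),\qquad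 N(\infty)=\infty .$$ 1. Let $\mathcal F$ be a family of bi-Lipschitz functions with constants $(c_1(f),c_2(f))$, $c_1(f)>0$, such that $c_2(f)/c_1(f)\le A$ and $c_1(f)^{-1}\le D$ for all $f\in\mathcal F$, and let $I$ be a closed interval of length $m$ contained in $\bigcap_{f\in\mathcal F}f^{-1}([0,1])$. Let $C\subset\mathbb R$ be compact with convex hull $[0,1]$ and $\tau(C)\,\beta\ge e$, and let $S=(-\infty,0)\cup C\cup(1,\infty)$. Then for every subfamily $\mathcal F_0\subset\mathcal F$ with at most $N(\tau(C))$ elements, $$\dim_{\rm H}\Bigl(I\cap\bigcap_{f\in\mathcal F_0}f^{-1}(S)\Bigr)>0 .$$ In particular $C$ contains the pattern $\mathcal F_0$; in fact the set of $t\in I$ with $f(t)\in C$ for all $f\in\mathcal F_0$ has positive Hausdorff dimension. 2. For fixed $A,D,m$ one has $N(\tau)\sim\tau/\log\tau$ as $\tau\to\infty$, that is, there are constants $K\ge 1$ and $\tau_0$ with $K^{-1}\frac{\tau}{\log\tau}\le N(\tau)\le K\frac{\tau}{\log\tau}$ for all $\tau\ge\tau_0$. -/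

import Mathlib

open Set MeasureTheory Filter Asymptotics
open scoped ENNReal Topology

/-- The gaps of a closed set `C` of reals, that is, the bounded connected components of `Cᶜ`. The
pair `(a, b)` stands for the open interval `Ioo a b`. -/
def gaps (C : Set ℝ) : Set (ℝ × ℝ) :=
  {g | g.1 < g.2 ∧ g.1 ∈ C ∧ g.2 ∈ C ∧ Disjoint (Ioo g.1 g.2) C}

/-- The order in which gaps are removed: longer gaps first, and gaps of the same length
from left to right. -/
def RemovedBefore (g' g : ℝ × ℝ) : Prop :=
  g.2 - g.1 < g'.2 - g'.1 ∨ (g'.2 - g'.1 = g.2 - g.1 ∧ g'.1 < g.1)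

/-- What is left of the convex hull of `C` just before the gap `g` is removed. -/
def remainingBefore (C : Set ℝ) (g : ℝ × ℝ) : Set ℝ :=
  convexHull ℝ C \ ⋃ g' ∈ {g' ∈ gaps C | RemovedBefore g' g}, Ioo g'.1 g'.2

/-- The closed interval from which the gap `g` is removed: the connected component of
`remainingBefore C g` that contains `Ioo g.1 g.2`. -/
def parentInterval (C : Set ℝ) (g : ℝ × ℝ) : Set ℝ :=
  connectedComponentIn (remainingBefore C g) ((g.1 + g.2) / 2)

/-- The left piece that remains of the parent interval when the gap `g` is removed. -/
def leftPiece (C : Set ℝ) (g : ℝ × ℝ) : Set ℝ := parentInterval C g ∩ Iic g.1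

/-- The right piece that remains of the parent interval when the gap `g` is removed. -/
def rightPiece (C : Set ℝ) (g : ℝ × ℝ) : Set ℝ := parentInterval C g ∩ Ici g.2

open Classical in
/-- Newhouse thickness of a compact set of reals. It is `0` for a singleton, and `∞` for a
non-degenerate interval (which has no gaps). -/
noncomputable def thickness (C : Set ℝ) : ℝ≥0∞ :=
  if C.Subsingleton then 0
  else ⨅ g ∈ gaps C,
    min (volume (leftPiece C g)) (volume (rightPiece C g)) / volume (Ioo g.1 g.2)

/-- `f` is bi-Lipschitz with constants `(c₁, c₂)`. -/
def IsBiLipschitz (f : ℝ → ℝ) (c₁ c₂ : ℝ) : Prop :=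
  ∀ x y : ℝ, c₁ * |x - y| ≤ |f x - f y| ∧ |f x - f y| ≤ c₂ * |x - y|

/-- `E` contains the pattern `(f i)`: there is `t` with `f i t ∈ E` for all `i`. -/
def ContainsPattern {Λ : Type*} (E : Set ℝ) (f : Λ → ℝ → ℝ) : Prop :=
  ∃ t : ℝ, ∀ i, f i t ∈ E

/-- The parameter `β = min {m / D, 1 / (4 A)}`. -/
noncomputable def patternBeta (A D m : ℝ) : ℝ := min (m / D) (1 / (4 * A))

/-- The number `N(τ)` for a finite thickness `τ`. -/
noncomputable def patternBound (A β τ : ℝ) : ℕ :=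
  ⌊τ * β / (720 ^ 2 * Real.exp 1 * A ^ (1 - 1 / Real.log (τ * β)))
    * (1 - β ^ (1 / Real.log (τ * β)))⌋₊

open Classical in
/-- The number `N(τ)` for `τ ∈ [0, ∞]`, with `N(∞) = ∞`. -/
noncomputable def patternBoundExt (A β : ℝ) (τ : ℝ≥0∞) : ℕ∞ :=
  if τ = ⊤ then ⊤ else (patternBound A β τ.toReal : ℕ∞)

/-!
The set of parameters `t ∈ I = [a, a + m]` to be found is what remains of `I` after the removal of
the obstacles `f ⁻¹' G`, where `f` runs over the `n ≤ N(τ)` functions and `G` over the gaps of `C`.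
The proof counts dyadic intervals.

*Separation.* Two distinct gaps of `C` have distance at least `τ` times the length of the smaller
one (`thickness_mul_min_le_abs_sub`), because the gap removed later is separated from the other one
by a piece of its parent interval. Hence the obstacles of one function have the same property
with the constant `σ = τ / A`. Gaps have length at most `1 / (2 τ)`, so with `X = τ β` all obstacles
have length at most `m / (2 X)`.

*Counting.* Divide `I` successively into `2 ^ l` closed cells of length `m / 2 ^ l`, and discard at
level `l` the cells that meet an obstacle whose length is about `m / 2 ^ l`. Fix `T` with
`2 ^ (T + 1) ≤ σ`. By separation, a cell of level `l - T` meets at most one such obstacle of each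
function, and each obstacle meets at most three cells of level `l`. So the numbers `b l` of surviving
cells satisfy `b l ≥ 2 b (l - 1) - 3 n b (l - T)`. Obstacles too large for level `T` are
treated at level `T`; there is at most one for each function, and as they are short compared with
`m / n`, half of the cells survive. If `48 T n ≤ 2 ^ T`, the recurrence propagates
`b (l + 1) ≥ (2 - 2 / T) b l` (`pos_of_delayed_recurrence`), and by compactness a point of `I`
escapes all obstacles (`exists_mem_Icc_avoiding`). Since `T` is about `log σ`, the condition on `n` is
a bound of order `σ / log σ`, which `N(τ)` satisfies (`exists_delay_of_le_patternBound`).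

*Dimension.* If the remaining set had dimension `0`, it could be covered by sets `V k` with
`∑ (diam (V k)) ^ (1 / 2)` as small as desired (`exists_sparse_cover_of_dimH_eq_zero`). As the growth
rate `2 - 2 / T` exceeds `√2`, the sets `V k` can be added to the obstacles without harm, and the
point found then lies in the remaining set but in none of the sets covering it.
-/

/-! ### Gaps and thickness -/

theorem min_mem_max_mem_of_convexHull_eq {C : Set ℝ} (hC : IsCompact C)
    (hull : convexHull ℝ C = Icc 0 1) : (0 : ℝ) ∈ C ∧ (1 : ℝ) ∈ C := by
  have hsub : C ⊆ Icc 0 1 := hull ▸ subset_convexHull ℝ C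
  have hne : C.Nonempty := by
    rw [← convexHull_nonempty_iff (𝕜 := ℝ), hull]
    exact ⟨0, by simp⟩
  have hull' : Icc (0 : ℝ) 1 ⊆ Icc (sInf C) (sSup C) := by
    rw [← hull]
    exact convexHull_min (fun x hx => ⟨csInf_le hC.bddBelow hx, le_csSup hC.bddAbove hx⟩)
      (convex_Icc _ _)
  have h0 := (hull' (left_mem_Icc.2 zero_le_one)).1
  have h1 := (hull' (right_mem_Icc.2 zero_le_one)).2
  have hi := hC.sInf_mem hne
  have hs := hC.sSup_mem hne
  constructor
  · rwa [le_antisymm h0 (hsub hi).1] at hi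
  · rwa [le_antisymm (hsub hs).2 h1] at hs

theorem exists_gap_of_notMem {C : Set ℝ} (hC : IsCompact C) (h0 : (0 : ℝ) ∈ C) (h1 : (1 : ℝ) ∈ C)
    {z : ℝ} (hz : z ∈ Icc 0 1) (hzC : z ∉ C) : ∃ g ∈ gaps C, z ∈ Ioo g.1 g.2 := by
  have hl := (hC.inter_right (isClosed_Iic (a := z))).sSup_mem ⟨0, h0, hz.1⟩
  have hr := (hC.inter_right (isClosed_Ici (a := z))).sInf_mem ⟨1, h1, hz.2⟩
  set l := sSup (C ∩ Iic z)
  set r := sInf (C ∩ Ici z)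
  have hlz : l < z := lt_of_le_of_ne hl.2 fun h => hzC (h ▸ hl.1)
  have hzr : z < r := lt_of_le_of_ne hr.2 fun h => hzC (h ▸ hr.1)
  refine ⟨(l, r), ⟨hlz.trans hzr, hl.1, hr.1, ?_⟩, hlz, hzr⟩
  rw [Set.disjoint_left]
  rintro x ⟨hx1, hx2⟩ hxC
  rcases le_total x z with h | h
  · exact hx1.not_ge (le_csSup (hC.inter_right isClosed_Iic).bddAbove ⟨hxC, h⟩)
  · exact hx2.not_ge (csInf_le (hC.inter_right isClosed_Ici).bddBelow ⟨hxC, h⟩)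

theorem eq_of_mem_gap_of_mem_gap {C : Set ℝ} {g g' : ℝ × ℝ} (hg : g ∈ gaps C) (hg' : g' ∈ gaps C)
    {x : ℝ} (hx : x ∈ Ioo g.1 g.2) (hx' : x ∈ Ioo g'.1 g'.2) : g = g' := by
  obtain ⟨-, h1, h2, hd⟩ := hg
  obtain ⟨-, h1', h2', hd'⟩ := hg'
  rw [Set.disjoint_left] at hd hd'
  refine Prod.ext (le_antisymm ?_ ?_) (le_antisymm ?_ ?_) <;> by_contra! h
  · exact hd' ⟨h, hx.1.trans hx'.2⟩ h1
  · exact hd ⟨h, hx'.1.trans hx.2⟩ h1'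
  · exact hd ⟨hx.1.trans hx'.2, h⟩ h2'
  · exact hd' ⟨hx'.1.trans hx.2, h⟩ h2

theorem removedBefore_or_removedBefore {g g' : ℝ × ℝ} (h : g ≠ g') :
    RemovedBefore g' g ∨ RemovedBefore g g' := by
  unfold RemovedBefore
  rcases lt_trichotomy (g.2 - g.1) (g'.2 - g'.1) with h1 | h1 | h1
  · exact Or.inl (Or.inl h1)
  · rcases lt_trichotomy g.1 g'.1 with h2 | h2 | h2
    · exact Or.inr (Or.inr ⟨h1, h2⟩)
    · exact absurd (Prod.ext h2 (by linarith)) h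
    · exact Or.inl (Or.inr ⟨h1.symm, h2⟩)
  · exact Or.inr (Or.inl h1)

theorem ordConnected_parentInterval (C : Set ℝ) (g : ℝ × ℝ) : (parentInterval C g).OrdConnected :=
  isPreconnected_connectedComponentIn.ordConnected

theorem parentInterval_subset (C : Set ℝ) (g : ℝ × ℝ) :
    parentInterval C g ⊆ remainingBefore C g :=
  connectedComponentIn_subset _ _

theorem midpoint_mem_parentInterval {C : Set ℝ} {g : ℝ × ℝ} (h : (parentInterval C g).Nonempty) :
    (g.1 + g.2) / 2 ∈ parentInterval C g :=
  mem_connectedComponentIn (connectedComponentIn_nonempty_iff.1 h)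

theorem notMem_parentInterval_of_removedBefore {C : Set ℝ} {g g' : ℝ × ℝ} (hg' : g' ∈ gaps C)
    (h : RemovedBefore g' g) {y : ℝ} (hy : y ∈ Ioo g'.1 g'.2) : y ∉ parentInterval C g := by
  intro hmem
  refine (parentInterval_subset C g hmem).2 ?_
  simp only [mem_iUnion]
  exact ⟨g', ⟨hg', h⟩, hy⟩

/-- The right piece ends at `e` or before if points outside the parent interval accumulate at `e`
from the right. -/
theorem rightPiece_subset {C : Set ℝ} {g : ℝ × ℝ} {e : ℝ} (hg : g.1 < g.2) (he : g.2 ≤ e)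
    (hout : ∀ p, e < p → ∃ y ∈ Ioc e p, y ∉ parentInterval C g) :
    rightPiece C g ⊆ Icc g.2 e := by
  rintro p ⟨hp, hpg⟩
  refine ⟨hpg, ?_⟩
  by_contra! h
  obtain ⟨y, hy, hyn⟩ := hout p h
  exact hyn ((ordConnected_parentInterval C g).out (midpoint_mem_parentInterval ⟨p, hp⟩) hp
    ⟨by linarith [hy.1], hy.2⟩)

/-- The left piece begins at `e` or after if points outside the parent interval accumulate at `e`
from the left. -/
theorem leftPiece_subset {C : Set ℝ} {g : ℝ × ℝ} {e : ℝ} (hg : g.1 < g.2) (he : e ≤ g.1)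
    (hout : ∀ p, p < e → ∃ y ∈ Ico p e, y ∉ parentInterval C g) :
    leftPiece C g ⊆ Icc e g.1 := by
  rintro p ⟨hp, hpg⟩
  refine ⟨?_, hpg⟩
  by_contra! h
  obtain ⟨y, hy, hyn⟩ := hout p h
  exact hyn ((ordConnected_parentInterval C g).out hp (midpoint_mem_parentInterval ⟨p, hp⟩)
    ⟨hy.1, by linarith [hy.2]⟩)

theorem thickness_le_of_mem_gaps {C : Set ℝ} (hC : ¬ C.Subsingleton) {g : ℝ × ℝ}
    (hg : g ∈ gaps C) : thickness C ≤
      min (volume (leftPiece C g)) (volume (rightPiece C g)) / volume (Ioo g.1 g.2) := by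
  rw [thickness, if_neg hC]
  exact iInf₂_le g hg

theorem thickness_toReal_mul_le {C : Set ℝ} (hC : ¬ C.Subsingleton) {g : ℝ × ℝ}
    (hg : g ∈ gaps C) {d : ℝ} (hd : 0 ≤ d)
    (h : volume (leftPiece C g) ≤ ENNReal.ofReal d ∨ volume (rightPiece C g) ≤ ENNReal.ofReal d) :
    (thickness C).toReal * (g.2 - g.1) ≤ d := by
  have hpos : 0 < g.2 - g.1 := sub_pos.2 hg.1
  have h1 : min (volume (leftPiece C g)) (volume (rightPiece C g)) ≤ ENNReal.ofReal d :=
    h.elim (fun h => (min_le_left _ _).trans h) (fun h => (min_le_right _ _).trans h)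
  have h2 : thickness C ≤ ENNReal.ofReal (d / (g.2 - g.1)) := by
    refine (thickness_le_of_mem_gaps hC hg).trans ?_
    rw [Real.volume_Ioo, ENNReal.ofReal_div_of_pos hpos]
    gcongr
  have h3 := ENNReal.toReal_mono ENNReal.ofReal_ne_top h2
  rw [ENNReal.toReal_ofReal (by positivity)] at h3
  rwa [← le_div_iff₀ hpos]

theorem volume_le_of_subset_Icc {s : Set ℝ} {a b : ℝ} (h : s ⊆ Icc a b) :
    volume s ≤ ENNReal.ofReal (b - a) :=
  (measure_mono h).trans Real.volume_Icc.le

/-- A gap is separated from every gap removed before it by a whole piece of its parent interval. -/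
theorem thickness_mul_le_of_removedBefore {C : Set ℝ} (hC : ¬ C.Subsingleton) {g g' : ℝ × ℝ}
    (hg : g ∈ gaps C) (hg' : g' ∈ gaps C) (h : RemovedBefore g' g) (hne : g ≠ g') {x y : ℝ}
    (hx : x ∈ Ioo g.1 g.2) (hy : y ∈ Ioo g'.1 g'.2) :
    (thickness C).toReal * (g.2 - g.1) ≤ |x - y| := by
  obtain ⟨hlt, h1, h2, hd⟩ := id hg
  obtain ⟨hlt', h1', h2', hd'⟩ := id hg'
  rw [Set.disjoint_left] at hd hd'
  rcases lt_trichotomy x y with hxy | hxy | hxy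
  · have hle : g.2 ≤ g'.1 := by
      by_contra! hcon
      rcases le_or_gt g'.1 x with h3 | h3
      · rcases h3.lt_or_eq with h3 | h3
        · exact hne (eq_of_mem_gap_of_mem_gap hg hg' hx ⟨h3, hxy.trans hy.2⟩)
        · exact hd hx (h3 ▸ h1')
      · exact hd ⟨hx.1.trans h3, hcon⟩ h1'
    have hsub : rightPiece C g ⊆ Icc g.2 g'.1 := by
      refine rightPiece_subset hlt hle fun p hp => ?_
      obtain ⟨z, hz1, hz2⟩ := exists_between (lt_min hp hlt')
      exact ⟨z, ⟨hz1, (hz2.trans_le (min_le_left _ _)).le⟩,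
        notMem_parentInterval_of_removedBefore hg' h ⟨hz1, hz2.trans_le (min_le_right _ _)⟩⟩
    have := thickness_toReal_mul_le hC hg (sub_nonneg.2 hle) (Or.inr (volume_le_of_subset_Icc hsub))
    rw [abs_sub_comm, abs_of_pos (sub_pos.2 hxy)]
    linarith [hx.2, hy.1]
  · exact absurd (eq_of_mem_gap_of_mem_gap hg hg' hx (hxy ▸ hy)) hne
  · have hle : g'.2 ≤ g.1 := by
      by_contra! hcon
      rcases le_or_gt x g'.2 with h3 | h3
      · rcases h3.lt_or_eq with h3 | h3
        · exact hne (eq_of_mem_gap_of_mem_gap hg hg' hx ⟨hy.1.trans hxy, h3⟩)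
        · exact hd hx (h3 ▸ h2')
      · exact hd ⟨hcon, h3.trans hx.2⟩ h2'
    have hsub : leftPiece C g ⊆ Icc g'.2 g.1 := by
      refine leftPiece_subset hlt hle fun p hp => ?_
      obtain ⟨z, hz1, hz2⟩ := exists_between (max_lt hp hlt')
      exact ⟨z, ⟨((le_max_left _ _).trans_lt hz1).le, hz2⟩,
        notMem_parentInterval_of_removedBefore hg' h ⟨(le_max_right _ _).trans_lt hz1, hz2⟩⟩
    have := thickness_toReal_mul_le hC hg (sub_nonneg.2 hle) (Or.inl (volume_le_of_subset_Icc hsub))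
    rw [abs_of_pos (sub_pos.2 hxy)]
    linarith [hx.1, hy.2]

/-- The separation property of thick sets: the distance of two distinct gaps is at least the
thickness times the length of the smaller one. -/
theorem thickness_mul_min_le_abs_sub {C : Set ℝ} (hC : ¬ C.Subsingleton) {g g' : ℝ × ℝ}
    (hg : g ∈ gaps C) (hg' : g' ∈ gaps C) (hne : g ≠ g') {x y : ℝ}
    (hx : x ∈ Ioo g.1 g.2) (hy : y ∈ Ioo g'.1 g'.2) :
    (thickness C).toReal * min (g.2 - g.1) (g'.2 - g'.1) ≤ |x - y| := by
  rcases removedBefore_or_removedBefore hne with h | h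
  · refine le_trans ?_ (thickness_mul_le_of_removedBefore hC hg hg' h hne hx hy)
    gcongr
    exact min_le_left _ _
  · rw [abs_sub_comm]
    refine le_trans ?_ (thickness_mul_le_of_removedBefore hC hg' hg h hne.symm hy hx)
    gcongr
    exact min_le_right _ _

theorem thickness_mul_length_le_half {C : Set ℝ} (hC : ¬ C.Subsingleton)
    (hull : convexHull ℝ C = Icc 0 1) {g : ℝ × ℝ} (hg : g ∈ gaps C) :
    (thickness C).toReal * (g.2 - g.1) ≤ 1 / 2 := by
  have hsub : C ⊆ Icc 0 1 := hull ▸ subset_convexHull ℝ C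
  have hpar : parentInterval C g ⊆ Icc 0 1 := fun x hx =>
    hull ▸ (parentInterval_subset C g hx).1
  have h1 := thickness_toReal_mul_le hC hg (sub_nonneg.2 (hsub hg.2.1).1)
    (Or.inl (volume_le_of_subset_Icc fun x hx => ⟨(hpar hx.1).1, hx.2⟩))
  have h2 := thickness_toReal_mul_le hC hg (sub_nonneg.2 (hsub hg.2.2.1).2)
    (Or.inr (volume_le_of_subset_Icc fun x hx => ⟨hx.2, (hpar hx.1).2⟩))
  linarith [hg.1]

theorem gaps_eq_empty_of_thickness_eq_top {C : Set ℝ} (hull : convexHull ℝ C = Icc 0 1)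
    (h : thickness C = ⊤) : gaps C = ∅ := by
  have hC : ¬ C.Subsingleton := fun hs => by simp [thickness, hs] at h
  rw [eq_empty_iff_forall_notMem]
  intro g hg
  have hpar : leftPiece C g ⊆ Icc 0 1 := fun x hx =>
    hull ▸ (parentInterval_subset C g hx.1).1
  have h1 := thickness_le_of_mem_gaps hC hg
  rw [h, top_le_iff, Real.volume_Ioo] at h1
  refine (ENNReal.div_lt_top (ne_of_lt ?_) ?_).ne h1
  · exact (min_le_left _ _).trans_lt
      ((volume_le_of_subset_Icc hpar).trans_lt ENNReal.ofReal_lt_top)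
  · simpa using hg.1

/-! ### Dyadic cells and their survivors -/

/-- The `p`-th of the `2 ^ l` closed dyadic subintervals of `Icc a (a + m)` of length
`m / 2 ^ l`, counted from `0`. -/
def dyadicCell (a m : ℝ) (l p : ℕ) : Set ℝ :=
  Icc (a + p * (m / 2 ^ l)) (a + (p + 1) * (m / 2 ^ l))

theorem dyadicCell_succ_subset {a m : ℝ} (hm : 0 < m) (l p : ℕ) :
    dyadicCell a m (l + 1) p ⊆ dyadicCell a m l (p / 2) := by
  have hr : 0 < m / 2 ^ (l + 1) := by positivity
  have hr2 : m / 2 ^ l = 2 * (m / 2 ^ (l + 1)) := by rw [pow_succ]; field_simp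
  have h1 : ((2 * (p / 2) : ℕ) : ℝ) ≤ p := by exact_mod_cast (by omega : 2 * (p / 2) ≤ p)
  have h2 : (p : ℝ) + 1 ≤ ((2 * (p / 2) + 2 : ℕ) : ℝ) := by
    exact_mod_cast (by omega : p + 1 ≤ 2 * (p / 2) + 2)
  push_cast at h1 h2
  rintro x ⟨hx1, hx2⟩
  constructor
  · rw [hr2]; nlinarith
  · rw [hr2]; nlinarith

theorem dyadicCell_add_subset {a m : ℝ} (hm : 0 < m) (l k p : ℕ) :
    dyadicCell a m (l + k) p ⊆ dyadicCell a m l (p / 2 ^ k) := by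
  induction k generalizing p with
  | zero => simp
  | succ k ih =>
    rw [pow_succ', ← Nat.div_div_eq_div_mul]
    exact (dyadicCell_succ_subset hm (l + k) p).trans (ih _)

theorem abs_sub_le_of_mem_dyadicCell {a m : ℝ} {l p : ℕ} {x y : ℝ}
    (hx : x ∈ dyadicCell a m l p) (hy : y ∈ dyadicCell a m l p) : |x - y| ≤ m / 2 ^ l := by
  obtain ⟨h1, h2⟩ := hx
  obtain ⟨h3, h4⟩ := hy
  rw [abs_le]
  constructor <;> linarith

/-- A set of diameter less than `u` meets at most `u / r + 2` cells of length `r`. -/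
theorem card_le_of_meets_dyadicCell {a m : ℝ} (hm : 0 < m) {l : ℕ} {U : Set ℝ} {u : ℝ}
    (hu : 0 ≤ u) (hU : ∀ x ∈ U, ∀ y ∈ U, |x - y| < u) (s : Finset ℕ)
    (hs : ∀ p ∈ s, (U ∩ dyadicCell a m l p).Nonempty) :
    (s.card : ℝ) ≤ u / (m / 2 ^ l) + 2 := by
  have hr : 0 < m / 2 ^ l := by positivity
  rcases s.eq_empty_or_nonempty with rfl | hne
  · simp only [Finset.card_empty, Nat.cast_zero]; positivity
  set p := s.min' hne
  set q := s.max' hne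
  have hsub : s ⊆ Finset.Icc p q := fun z hz =>
    Finset.mem_Icc.2 ⟨s.min'_le z hz, s.le_max' z hz⟩
  have hpq : p ≤ q := s.min'_le q (s.max'_mem hne)
  have hcard := Finset.card_le_card hsub
  rw [Nat.card_Icc] at hcard
  have hcard' : (s.card : ℝ) + p ≤ q + 1 := by exact_mod_cast (by omega : s.card + p ≤ q + 1)
  obtain ⟨x, hxU, hx⟩ := hs p (s.min'_mem hne)
  obtain ⟨y, hyU, hy⟩ := hs q (s.max'_mem hne)
  have h1 : y - x < u := (le_abs_self _).trans_lt (hU y hyU x hxU)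
  have h2 := hx.2
  have h3 := hy.1
  have h4 : ((q : ℝ) - p - 1) * (m / 2 ^ l) ≤ u := by linarith
  rw [← le_div_iff₀ hr] at h4
  linarith

/-- The two children of each of the cells with numbers in `s`. -/
def children (s : Finset ℕ) : Finset ℕ := s.biUnion fun q => {2 * q, 2 * q + 1}

theorem mem_children {s : Finset ℕ} {p : ℕ} : p ∈ children s ↔ p / 2 ∈ s := by
  simp only [children, Finset.mem_biUnion, Finset.mem_insert, Finset.mem_singleton]
  constructor
  · rintro ⟨q, hq, rfl | rfl⟩
    · simpa using hq
    · rwa [show (2 * q + 1) / 2 = q by omega]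
  · intro h
    exact ⟨p / 2, h, by omega⟩

theorem card_children (s : Finset ℕ) : (children s).card = 2 * s.card := by
  rw [children, Finset.card_biUnion]
  · rw [Finset.sum_congr rfl (fun q _ => Finset.card_pair (by omega : 2 * q ≠ 2 * q + 1))]
    simp [mul_comm]
  · intro x _ y _ hxy
    rw [Function.onFun, Finset.disjoint_left]
    intro z hz hz'
    simp only [Finset.mem_insert, Finset.mem_singleton] at hz hz'
    omega

open Classical in
/-- The (numbers of the) dyadic cells of level `l` such that neither they nor any cell above
them is `bad`; the cell of level `0` always survives. -/
noncomputable def survivors (bad : ℕ → ℕ → Prop) : ℕ → Finset ℕ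
  | 0 => {0}
  | l + 1 => (children (survivors bad l)).filter fun p => ¬ bad (l + 1) p

theorem mem_survivors_succ {bad : ℕ → ℕ → Prop} {l p : ℕ} :
    p ∈ survivors bad (l + 1) ↔ p / 2 ∈ survivors bad l ∧ ¬ bad (l + 1) p := by
  simp [survivors, mem_children]

theorem div_pow_mem_survivors {bad : ℕ → ℕ → Prop} {l k p : ℕ}
    (hp : p ∈ survivors bad (l + k)) : p / 2 ^ k ∈ survivors bad l := by
  induction k generalizing p with
  | zero => simpa using hp
  | succ k ih =>
    rw [pow_succ', ← Nat.div_div_eq_div_mul]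
    exact ih (mem_survivors_succ.1 hp).1

theorem card_survivors_le (bad : ℕ → ℕ → Prop) (l : ℕ) : (survivors bad l).card ≤ 2 ^ l := by
  induction l with
  | zero => simp [survivors]
  | succ l ih =>
    classical
    refine (Finset.card_filter_le _ _).trans ?_
    rw [card_children, pow_succ']
    omega

theorem card_survivors_succ (bad : ℕ → ℕ → Prop) (l : ℕ) [DecidablePred (bad (l + 1))] :
    (survivors bad (l + 1)).card + ((children (survivors bad l)).filter (bad (l + 1))).card
      = 2 * (survivors bad l).card := by
  rw [← card_children, ← Finset.card_filter_add_card_filter_not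
    (s := children (survivors bad l)) (bad (l + 1)), add_comm, survivors]
  congr!

theorem card_survivors_of_not_bad {bad : ℕ → ℕ → Prop} {l : ℕ} (h : ∀ k ≤ l, ∀ p, ¬ bad k p) :
    (survivors bad l).card = 2 ^ l := by
  classical
  induction l with
  | zero => simp [survivors]
  | succ l ih =>
    have h1 := card_survivors_succ bad l
    rw [Finset.filter_false_of_mem fun p _ => h (l + 1) le_rfl p,
      ih fun k hk => h k (hk.trans l.le_succ), Finset.card_empty] at h1
    rw [pow_succ']
    exact h1

/-- If cells survive at every level, then some point of `Icc a (a + m)` lies in surviving cells of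
all levels. -/
theorem exists_mem_survivors {a m : ℝ} (hm : 0 < m) {bad : ℕ → ℕ → Prop}
    (h : ∀ l, (survivors bad l).Nonempty) :
    ∃ t ∈ Icc a (a + m), ∀ l, ∃ p ∈ survivors bad l, t ∈ dyadicCell a m l p := by
  let K : ℕ → Set ℝ := fun l => ⋃ p ∈ survivors bad l, dyadicCell a m l p
  have hcomp : ∀ l, IsCompact (K l) := fun l =>
    (survivors bad l).isCompact_biUnion fun p _ => isCompact_Icc
  have hne : (⋂ l, K l).Nonempty := by
    refine IsCompact.nonempty_iInter_of_sequence_nonempty_isCompact_isClosed K (fun l => ?_)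
      (fun l => ?_) (hcomp 0) (fun l => (hcomp l).isClosed)
    · intro x hx
      simp only [K, mem_iUnion, exists_prop] at hx ⊢
      obtain ⟨p, hp, hx⟩ := hx
      exact ⟨p / 2, (mem_survivors_succ.1 hp).1, dyadicCell_succ_subset hm l p hx⟩
    · obtain ⟨p, hp⟩ := h l
      refine ⟨a + p * (m / 2 ^ l), mem_biUnion hp ⟨le_rfl, ?_⟩⟩
      have : 0 < m / 2 ^ l := by positivity
      nlinarith
  obtain ⟨t, ht⟩ := hne
  have ht' : ∀ l, ∃ p ∈ survivors bad l, t ∈ dyadicCell a m l p := by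
    intro l
    simpa [K] using mem_iInter.1 ht l
  refine ⟨t, ?_, ht'⟩
  obtain ⟨p, hp, htp⟩ := ht' 0
  simp only [survivors, Finset.mem_singleton] at hp
  simpa [hp, dyadicCell] using htp

theorem one_third_le_one_sub_inv_pow (s : ℕ) (hs : 1 ≤ s) :
    (1 / 3 : ℝ) ≤ (1 - 1 / (s + 1)) ^ s := by
  have hs' : (0 : ℝ) < s := by exact_mod_cast hs
  have h1 : (1 - 1 / ((s : ℝ) + 1)) = (1 + 1 / (s : ℝ))⁻¹ := by field_simp; ring
  have h2 : (1 + 1 / (s : ℝ)) ^ s ≤ 3 := by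
    calc (1 + 1 / (s : ℝ)) ^ s ≤ (Real.exp (1 / s)) ^ s := by
          gcongr
          linarith [Real.add_one_le_exp (1 / (s : ℝ))]
      _ = Real.exp 1 := by rw [← Real.exp_nat_mul]; congr 1; field_simp
      _ ≤ 3 := by linarith [Real.exp_one_lt_d9]
  rw [h1, inv_pow, one_div]
  exact inv_anti₀ (by positivity) h2

/-- A sequence that loses at each step only a small multiple of a much earlier term, and an error
of order `(3 / 2) ^ k`, stays positive: from the index `T` on it grows at each step by the factor
`c = 2 - 2 / T`. Half of the allowed loss `2 / T` pays for the delayed term, for which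
`c ^ (T - 2) ≥ 2 ^ (T - 2) / 3` is needed, and the other half for the error. -/
theorem pos_of_delayed_recurrence {b : ℕ → ℝ} {n ε : ℝ} {T : ℕ} (hT : 4 ≤ T) (hn : 0 ≤ n)
    (hb0 : ∀ k, 0 ≤ b k) (hb : ∀ k, b k ≤ 2 ^ k) (hbT : 2 ^ T / 2 ≤ b T)
    (hnT : 48 * T * n ≤ 2 ^ T) (hε : 3 * T * (3 / 2) ^ (T + 1) * ε ≤ 1)
    (hrec : ∀ k, 2 * b (T + k) - 3 * n * b (k + 1) - 3 * (ε * (3 / 2) ^ (T + k + 1))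
      ≤ b (T + k + 1)) (k : ℕ) : 0 < b (T + k) := by
  obtain ⟨r, rfl⟩ : ∃ r, T = r + 2 := ⟨T - 2, by omega⟩
  have hr2 : (2 : ℝ) ≤ r := by exact_mod_cast (by omega : 2 ≤ r)
  set T : ℝ := ((r + 2 : ℕ) : ℝ) with hTdef
  have hTr : T = r + 2 := by simp [hTdef]
  have hT0 : 0 < T := by linarith
  set c : ℝ := 2 - 2 / T with hc
  have hc2 : c ≤ 2 := by have : 0 < 2 / T := by positivity
                         linarith
  have hc32 : 3 / 2 ≤ c := by
    have : 2 / T ≤ 1 / 2 := by rw [div_le_div_iff₀ hT0 (by norm_num)]; linarith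
    linarith
  have hc1 : 1 ≤ c := by linarith
  have hcr : 2 ^ r / 3 ≤ c ^ r := by
    have h1 := one_third_le_one_sub_inv_pow (r + 1) (by omega)
    have hT' : ((r + 1 : ℕ) : ℝ) + 1 = T := by rw [hTr]; push_cast; ring
    rw [hT'] at h1
    have hTi : 0 < 1 / T := by positivity
    have hTi' : 1 / T ≤ 1 := by rw [div_le_one hT0]; linarith
    have h2 : (1 - 1 / T) ^ (r + 1) ≤ (1 - 1 / T) ^ r :=
      pow_le_pow_of_le_one (by linarith) (by linarith) (by omega)
    have h3 : c ^ r = 2 ^ r * (1 - 1 / T) ^ r := by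
      rw [← mul_pow]; congr 1; rw [hc]; ring
    rw [h3, div_eq_mul_one_div]
    gcongr
    linarith
  have hn' : 3 * n * T ≤ c ^ r := by
    have : (2 : ℝ) ^ (r + 2) = 4 * 2 ^ r := by ring
    rw [this] at hnT
    nlinarith
  have hpow : ∀ i : ℕ, 0 < c ^ i := fun i => by positivity
  -- the growth over any number of steps after `T`
  have Q : ∀ k, ∀ i ≤ k, b (r + 2 + i) * c ^ (k - i) ≤ b (r + 2 + k) := by
    intro k
    induction k with
    | zero => intro i hi; obtain rfl : i = 0 := by omega
              simp
    | succ k ih =>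
      have hlow : c ^ k * (2 * 2 ^ r) ≤ b (r + 2 + k) := by
        have h0 := ih 0 (Nat.zero_le _)
        rw [Nat.sub_zero, Nat.add_zero] at h0
        have : (2 : ℝ) ^ (r + 2) / 2 = 2 * 2 ^ r := by ring
        rw [this] at hbT
        calc c ^ k * (2 * 2 ^ r) ≤ c ^ k * b (r + 2) := by gcongr
          _ ≤ _ := by linarith
      -- before the index `T` the growth is unknown, and the trivial bound `b k ≤ 2 ^ k` is used
      have hdelay : b (k + 1) * c ^ r ≤ b (r + 2 + k) := by
        rcases le_or_gt k r with hk | hk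
        · have h1 : c ^ r ≤ c ^ k * 2 ^ (r - k) := by
            calc c ^ r = c ^ k * c ^ (r - k) := by rw [← pow_add]; congr 1; omega
              _ ≤ _ := by gcongr
          calc b (k + 1) * c ^ r ≤ 2 ^ (k + 1) * (c ^ k * 2 ^ (r - k)) := by
                gcongr
                exact hb _
            _ = c ^ k * (2 * 2 ^ (k + (r - k))) := by ring
            _ = c ^ k * (2 * 2 ^ r) := by rw [Nat.add_sub_cancel' hk]
            _ ≤ _ := hlow
        · obtain ⟨i, rfl⟩ : ∃ i, k = i + (r + 1) := ⟨k - (r + 1), by omega⟩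
          have h1 := ih i (by omega)
          rw [Nat.add_sub_cancel_left] at h1
          have h2 : i + (r + 1) + 1 = r + 2 + i := by omega
          rw [h2]
          refine le_trans ?_ h1
          have h3 : c ^ r ≤ c ^ (i + (r + 1) - i) := pow_le_pow_right₀ hc1 (by omega)
          rw [Nat.add_sub_cancel_left] at h3
          exact mul_le_mul_of_nonneg_left h3 (hb0 _)
      have herr : 3 * (ε * (3 / 2) ^ (r + 2 + k + 1)) * T ≤ b (r + 2 + k) := by
        have h1 : (3 / 2 : ℝ) ^ k ≤ c ^ k * (2 * 2 ^ r) := by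
          have h3 : (3 / 2 : ℝ) ^ k ≤ c ^ k := by gcongr
          have h4 : (1 : ℝ) ≤ 2 ^ r := one_le_pow₀ (by norm_num)
          nlinarith [hpow k]
        calc 3 * (ε * (3 / 2) ^ (r + 2 + k + 1)) * T
            = (3 * T * (3 / 2) ^ (r + 2 + 1) * ε) * (3 / 2) ^ k := by ring
          _ ≤ 1 * (3 / 2) ^ k := by gcongr
          _ ≤ _ := by linarith
      have hloss : 3 * n * b (k + 1) * T ≤ b (r + 2 + k) := by
        calc 3 * n * b (k + 1) * T = b (k + 1) * (3 * n * T) := by ring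
          _ ≤ b (k + 1) * c ^ r := by
            gcongr
            exact hb0 _
          _ ≤ _ := hdelay
      have hstep : c * b (r + 2 + k) ≤ b (r + 2 + (k + 1)) := by
        refine le_trans ?_ (hrec k)
        have h1 : 3 * n * b (k + 1) ≤ b (r + 2 + k) / T := (le_div_iff₀ hT0).2 hloss
        have h2 := (le_div_iff₀ hT0).2 herr
        have h3 : c * b (r + 2 + k) = 2 * b (r + 2 + k) - 2 * (b (r + 2 + k) / T) := by
          rw [hc]; ring
        linarith
      intro i hi
      rcases hi.eq_or_lt with rfl | hi
      · simp
      · have h1 := ih i (by omega)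
        rw [show k + 1 - i = (k - i) + 1 by omega, pow_succ]
        calc b (r + 2 + i) * (c ^ (k - i) * c) = c * (b (r + 2 + i) * c ^ (k - i)) := by ring
          _ ≤ c * b (r + 2 + k) := by gcongr
          _ ≤ _ := hstep
  have h0 := Q k 0 (Nat.zero_le _)
  refine lt_of_lt_of_le ?_ h0
  rw [Nat.add_zero]
  have : (0 : ℝ) < 2 ^ (r + 2) / 2 := by positivity
  have := this.trans_le hbT
  positivity

/-! ### Avoiding separated obstacles -/

theorem exists_dyadic_level {m u : ℝ} (hu : 0 < u) (hum : u ≤ m) :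
    ∃ l : ℕ, u ≤ m / 2 ^ l ∧ m / 2 ^ (l + 1) < u := by
  obtain ⟨l, h1, h2⟩ := exists_nat_pow_near ((one_le_div hu).2 hum) (one_lt_two (α := ℝ))
  refine ⟨l, ?_, ?_⟩
  · rw [le_div_iff₀ hu] at h1
    rw [le_div_iff₀ (by positivity)]
    linarith
  · rw [div_lt_iff₀ hu] at h2
    rw [div_lt_iff₀ (by positivity)]
    linarith

/-- Obstacles smaller than the scale `m / 2 ^ T` are assigned the level of their own dyadic scale,
the larger ones the level `T`. -/
theorem exists_obstacle_level {m u : ℝ} (hm : 0 < m) (hu : 0 < u) (hum : u ≤ m) (T : ℕ) :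
    ∃ l : ℕ, T ≤ l ∧ m / 2 ^ (l + 1) < u ∧ (l = T ∨ u ≤ m / 2 ^ l) := by
  obtain ⟨l, h1, h2⟩ := exists_dyadic_level hu hum
  rcases le_total T l with h | h
  · exact ⟨l, h, h2, Or.inr h1⟩
  · refine ⟨T, le_rfl, lt_of_le_of_lt ?_ h2, Or.inl rfl⟩
    gcongr
    norm_num

/-- Finitely many families of obstacles `U i j`, each of them well separated at every scale,
together with a sparse sequence of small obstacles `V k`, cannot cover an interval. -/
theorem exists_mem_Icc_avoiding {ι J : Type*} [Fintype ι] [Nonempty ι] {a m σ X ε : ℝ} {T : ℕ}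
    {U : ι → J → Set ℝ} {u : ι → J → ℝ} {V : ℕ → Set ℝ} {L : ℕ → ℕ}
    (hm : 0 < m) (hupos : ∀ i j, 0 < u i j)
    (hdiam : ∀ i j, ∀ x ∈ U i j, ∀ y ∈ U i j, |x - y| < u i j)
    (hu : ∀ i j, u i j ≤ m / (2 * X))
    (hsep : ∀ i j j', j ≠ j' → ∀ x ∈ U i j, ∀ y ∈ U i j',
      σ * min (u i j) (u i j') ≤ |x - y|)
    (hX1 : 1 ≤ X) (hX : 2 * (Fintype.card ι : ℝ) ≤ X) (hT : 4 ≤ T)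
    (hnT : 48 * T * (Fintype.card ι : ℝ) ≤ 2 ^ T) (hσ : 2 ^ (T + 1) ≤ σ)
    (hVdiam : ∀ k, ∀ x ∈ V k, ∀ y ∈ V k, |x - y| < m / 2 ^ L k) (hLT : ∀ k, T < L k)
    (hε : 3 * T * (3 / 2) ^ (T + 1) * ε ≤ 1)
    (hL : ∀ l, ∀ F : Finset ℕ, (∀ k ∈ F, L k = l) → (F.card : ℝ) ≤ ε * (3 / 2) ^ l) :
    ∃ t ∈ Icc a (a + m), (∀ i j, t ∉ U i j) ∧ ∀ k, t ∉ V k := by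
  classical
  have hum : ∀ i j, u i j ≤ m := fun i j =>
    (hu i j).trans (div_le_self hm.le (by linarith))
  choose lev hlevT hlev1 hlev2 using fun i j => exists_obstacle_level hm (hupos i j) (hum i j) T
  set n : ℝ := (Fintype.card ι : ℝ) with hn
  have hn0 : 0 ≤ n := Nat.cast_nonneg _
  let gapBad : ℕ → ℕ → Prop := fun l p =>
    ∃ i j, lev i j = l ∧ (U i j ∩ dyadicCell a m l p).Nonempty
  let covBad : ℕ → ℕ → Prop := fun l p => ∃ k, L k = l ∧ (V k ∩ dyadicCell a m l p).Nonempty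
  let bad : ℕ → ℕ → Prop := fun l p => gapBad l p ∨ covBad l p
  -- of each family, at most one obstacle of level `T + k` meets a given cell of level `k`
  have huniq : ∀ k q i j j', lev i j = T + k → lev i j' = T + k →
      (U i j ∩ dyadicCell a m k q).Nonempty → (U i j' ∩ dyadicCell a m k q).Nonempty → j = j' := by
    rintro k q i j j' hj hj' ⟨x, hxU, hx⟩ ⟨y, hyU, hy⟩
    by_contra hne
    have h1 := hsep i j j' hne x hxU y hyU
    have h2 := abs_sub_le_of_mem_dyadicCell hx hy
    have h3 : m / 2 ^ (T + k + 1) < min (u i j) (u i j') :=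
      lt_min (hj ▸ hlev1 i j) (hj' ▸ hlev1 i j')
    have h4 : m / 2 ^ k = 2 ^ (T + 1) * (m / 2 ^ (T + k + 1)) := by
      rw [show T + k + 1 = (T + 1) + k by omega, pow_add _ (T + 1) k]
      field_simp
    have h5 : 2 ^ (T + 1) * (m / 2 ^ (T + k + 1)) < σ * min (u i j) (u i j') :=
      mul_lt_mul' hσ h3 (by positivity) ((by positivity : (0 : ℝ) < 2 ^ (T + 1)).trans_le hσ)
    linarith
  have hcov : ∀ l (s : Finset ℕ), (∀ p ∈ s, covBad l p) →
      (s.card : ℝ) ≤ 3 * (ε * (3 / 2) ^ l) := by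
    intro l s hs
    choose! κ hκ hκ' using hs
    have h1 : s.card ≤ 3 * (s.image κ).card := by
      refine Finset.card_le_mul_card_image s 3 fun k hk => ?_
      have hLk : L k = l := by
        obtain ⟨p, hp, rfl⟩ := Finset.mem_image.1 hk
        exact hκ p hp
      have h2 := card_le_of_meets_dyadicCell (a := a) hm (l := l) (u := m / 2 ^ l) (by positivity)
        (by simpa [hLk] using hVdiam k) (s.filter fun p => κ p = k) (by
          intro p hp
          obtain ⟨hps, rfl⟩ := Finset.mem_filter.1 hp
          exact hκ' p hps)
      rw [div_self (by positivity)] at h2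
      exact_mod_cast (by linarith : ((s.filter fun p => κ p = k).card : ℝ) ≤ 3)
    have h2 := hL l (s.image κ) (by
      intro k hk
      obtain ⟨p, hp, rfl⟩ := Finset.mem_image.1 hk
      exact hκ p hp)
    have h3 : (s.card : ℝ) ≤ 3 * ((s.image κ).card : ℝ) := by exact_mod_cast h1
    linarith
  have hearly : (survivors bad (T - 1)).card = 2 ^ (T - 1) := by
    refine card_survivors_of_not_bad fun k hk p => ?_
    rintro (⟨i, j, h, -⟩ | ⟨j, h, -⟩)
    · have := hlevT i j
      omega
    · have := hLT j
      omega
  -- the large obstacles destroy at most half of the cells of level `T`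
  have hbT : (2 : ℝ) ^ T / 2 ≤ (survivors bad T).card := by
    obtain ⟨S, rfl⟩ : ∃ S, T = S + 1 := ⟨T - 1, by omega⟩
    rw [Nat.add_sub_cancel] at hearly
    have h1 := card_survivors_succ bad S
    rw [hearly] at h1
    set s := (children (survivors bad S)).filter (bad (S + 1))
    have h2 : ∀ p ∈ s, gapBad (S + 1) p := by
      intro p hp
      rcases (Finset.mem_filter.1 hp).2 with h | ⟨k, hk, -⟩
      · exact h
      · have := hLT k
        omega
    have hroot : ∀ p ∈ s, dyadicCell a m (S + 1) p ⊆ dyadicCell a m 0 0 := by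
      intro p hp
      have h3 : p / 2 ∈ survivors bad (0 + S) := by
        simpa using mem_children.1 (Finset.mem_filter.1 hp).1
      have h4 := div_pow_mem_survivors h3
      rw [Nat.div_div_eq_div_mul, ← pow_succ'] at h4
      simp only [survivors, Finset.mem_singleton] at h4
      have h5 := dyadicCell_add_subset (a := a) hm 0 (S + 1) p
      rwa [h4, Nat.zero_add] at h5
    choose! f hf using h2
    set M : ℕ := ⌊(2 : ℝ) ^ (S + 1) / (2 * X) + 2⌋₊
    have h3 : s.card ≤ M * (Finset.univ : Finset ι).card := by
      refine Finset.card_le_mul_card_image_of_maps_to (f := f) (fun _ _ => Finset.mem_univ _) M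
        fun i _ => ?_
      rcases (s.filter fun p => f p = i).eq_empty_or_nonempty with h | ⟨p₀, hp₀i⟩
      · simp [h]
      obtain ⟨hp₀, rfl⟩ := Finset.mem_filter.1 hp₀i
      obtain ⟨j, hj, hjU⟩ := hf p₀ hp₀
      refine Nat.le_floor ?_
      refine (card_le_of_meets_dyadicCell (a := a) hm (l := S + 1) (hupos (f p₀) j).le
        (hdiam (f p₀) j) _ ?_).trans ?_
      · intro p hp
        obtain ⟨hp, hfp⟩ := Finset.mem_filter.1 hp
        obtain ⟨j', hj', hjU'⟩ := hf p hp
        rw [hfp] at hj' hjU'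
        rwa [huniq 0 0 (f p₀) j j' hj hj' (hjU.mono (inter_subset_inter_right _ (hroot p₀ hp₀)))
          (hjU'.mono (inter_subset_inter_right _ (hroot p hp)))]
      · have h4 : u (f p₀) j / (m / 2 ^ (S + 1)) ≤ (m / (2 * X)) / (m / 2 ^ (S + 1)) := by
          gcongr
          exact hu _ _
        have h5 : (m / (2 * X)) / (m / 2 ^ (S + 1)) = 2 ^ (S + 1) / (2 * X) := by field_simp
        linarith
    have h4 : (M : ℝ) ≤ 2 ^ (S + 1) / (2 * X) + 2 := Nat.floor_le (by positivity)
    have h5 : (s.card : ℝ) ≤ (2 ^ (S + 1) / (2 * X) + 2) * n := by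
      calc (s.card : ℝ) ≤ M * n := by rw [hn]; exact_mod_cast h3
        _ ≤ _ := by gcongr
    have h6 : (2 : ℝ) ^ (S + 1) / (2 * X) * n ≤ 2 ^ (S + 1) / 4 := by
      have : n / (2 * X) ≤ 1 / 4 := by
        rw [div_le_div_iff₀ (by positivity) (by norm_num)]; linarith
      calc (2 : ℝ) ^ (S + 1) / (2 * X) * n = 2 ^ (S + 1) * (n / (2 * X)) := by ring
        _ ≤ 2 ^ (S + 1) * (1 / 4) := by gcongr
        _ = _ := by ring
    have h7 : (8 : ℝ) * n ≤ 2 ^ (S + 1) := by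
      refine le_trans ?_ hnT
      have : (4 : ℝ) ≤ ((S + 1 : ℕ) : ℝ) := by exact_mod_cast hT
      nlinarith
    have h8 : ((survivors bad (S + 1)).card : ℝ) + s.card = 2 ^ (S + 1) := by
      rw [pow_succ']
      exact_mod_cast h1
    linarith
  -- later on, the cells destroyed at level `T + k + 1` are charged to their ancestors
  -- of level `k + 1`
  have hrec : ∀ k, 2 * ((survivors bad (T + k)).card : ℝ) - 3 * n * (survivors bad (k + 1)).card
      - 3 * (ε * (3 / 2) ^ (T + k + 1)) ≤ (survivors bad (T + k + 1)).card := by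
    intro k
    have h1 := card_survivors_succ bad (T + k)
    set s := (children (survivors bad (T + k))).filter (bad (T + k + 1))
    set s₁ := s.filter (gapBad (T + k + 1))
    set s₂ := s.filter (fun p => ¬ gapBad (T + k + 1) p)
    have h2 : s₁.card + s₂.card = s.card := Finset.card_filter_add_card_filter_not _
    have h3 : (s₂.card : ℝ) ≤ 3 * (ε * (3 / 2) ^ (T + k + 1)) := by
      refine hcov _ _ fun p hp => ?_
      obtain ⟨hp, hp'⟩ := Finset.mem_filter.1 hp
      exact (Finset.mem_filter.1 hp).2.resolve_left hp'
    have hanc : ∀ p ∈ s₁, p / 2 ^ T ∈ survivors bad (k + 1) := by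
      intro p hp
      have h4 := mem_children.1 (Finset.mem_filter.1 (Finset.mem_filter.1 hp).1).1
      rw [show T + k = (k + 1) + (T - 1) by omega] at h4
      have h5 := div_pow_mem_survivors h4
      rwa [Nat.div_div_eq_div_mul, ← pow_succ', Nat.sub_add_cancel (by omega)] at h5
    have hcell : ∀ p, dyadicCell a m (T + k + 1) p ⊆ dyadicCell a m (k + 1) (p / 2 ^ T) := by
      intro p
      have h5 := dyadicCell_add_subset (a := a) hm (k + 1) T p
      rwa [show k + 1 + T = T + k + 1 by omega] at h5
    have hgap : ∀ p ∈ s₁, gapBad (T + k + 1) p := fun p hp => (Finset.mem_filter.1 hp).2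
    choose! f hf using hgap
    have h4 : s₁.card ≤ 3 * (survivors bad (k + 1) ×ˢ (Finset.univ : Finset ι)).card := by
      refine Finset.card_le_mul_card_image_of_maps_to (f := fun p => (p / 2 ^ T, f p))
        (fun p hp => Finset.mem_product.2 ⟨hanc p hp, Finset.mem_univ _⟩) 3 ?_
      rintro ⟨q, i⟩ -
      rcases (s₁.filter fun p => (p / 2 ^ T, f p) = (q, i)).eq_empty_or_nonempty with h | ⟨p₀, hp₀i⟩
      · rw [h, Finset.card_empty]
        exact Nat.zero_le _
      obtain ⟨hp₀, heq⟩ := Finset.mem_filter.1 hp₀i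
      simp only [Prod.mk.injEq] at heq
      obtain ⟨rfl, rfl⟩ := heq
      obtain ⟨j, hj, hjU⟩ := hf p₀ hp₀
      have hju : u (f p₀) j ≤ m / 2 ^ (T + k + 1) := by
        have h6 := hlev2 (f p₀) j
        rw [hj] at h6
        exact h6.resolve_left (by omega)
      have h5 := card_le_of_meets_dyadicCell (a := a) hm (l := T + k + 1) (u := m / 2 ^ (T + k + 1))
        (by positivity) (fun x hx y hy => (hdiam (f p₀) j x hx y hy).trans_le hju)
        (s₁.filter fun p => (p / 2 ^ T, f p) = (p₀ / 2 ^ T, f p₀)) (by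
          intro p hp
          obtain ⟨hp, heq⟩ := Finset.mem_filter.1 hp
          simp only [Prod.mk.injEq] at heq
          obtain ⟨hq, hfp⟩ := heq
          obtain ⟨j', hj', hjU'⟩ := hf p hp
          rw [hfp] at hj' hjU'
          have h7 := hcell p
          rw [hq] at h7
          rwa [huniq (k + 1) (p₀ / 2 ^ T) (f p₀) j j' hj hj'
            (hjU.mono (inter_subset_inter_right _ (hcell p₀)))
            (hjU'.mono (inter_subset_inter_right _ h7))])
      rw [div_self (by positivity)] at h5
      exact_mod_cast h5.trans (by norm_num : (1 : ℝ) + 2 ≤ 3)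
    rw [Finset.card_product, Finset.card_univ] at h4
    have h5 : (s₁.card : ℝ) ≤ 3 * ((survivors bad (k + 1)).card * n) := by
      rw [hn]; exact_mod_cast h4
    have h6 : ((survivors bad (T + k + 1)).card : ℝ) + s.card
        = 2 * (survivors bad (T + k)).card := by
      exact_mod_cast h1
    have h7 : (s₁.card : ℝ) + s₂.card = s.card := by exact_mod_cast h2
    linarith
  have hpos := pos_of_delayed_recurrence (b := fun l => ((survivors bad l).card : ℝ)) hT hn0
    (fun _ => Nat.cast_nonneg _) (fun l => by exact_mod_cast card_survivors_le bad l) hbT hnT hε hrec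
  have hsurv : ∀ l, (survivors bad l).Nonempty := by
    intro l
    have h1 := hpos l
    rw [Nat.cast_pos, Finset.card_pos, add_comm] at h1
    obtain ⟨p, hp⟩ := h1
    exact ⟨_, div_pow_mem_survivors hp⟩
  obtain ⟨t, htI, ht⟩ := exists_mem_survivors (a := a) hm hsurv
  have hgood : ∀ l, l ≠ 0 → ∃ p, t ∈ dyadicCell a m l p ∧ ¬ bad l p := by
    intro l hl
    obtain ⟨p, hp, htp⟩ := ht l
    obtain ⟨l, rfl⟩ := Nat.exists_eq_succ_of_ne_zero hl
    exact ⟨p, htp, (mem_survivors_succ.1 hp).2⟩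
  refine ⟨t, htI, fun i j htU => ?_, fun k htV => ?_⟩
  · obtain ⟨p, htp, hbad⟩ := hgood (lev i j) (by have := hlevT i j; omega)
    exact hbad (Or.inl ⟨i, j, rfl, t, htU, htp⟩)
  · obtain ⟨p, htp, hbad⟩ := hgood (L k) (by have := hLT k; omega)
    exact hbad (Or.inr ⟨k, rfl, t, htV, htp⟩)

/-- A set of dimension `0` is covered by a sequence of sets of which at most `ε (3 / 2) ^ l` are
assigned to the dyadic scale `m / 2 ^ l`. A cover with small sum of the square roots of the
diameters has this property, as `2 ^ (1 / 2) ≤ 3 / 2`. -/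
theorem exists_sparse_cover_of_dimH_eq_zero {K : Set ℝ} (hK : dimH K = 0) {m ε : ℝ} (hm : 0 < m)
    (hε : 0 < ε) (T : ℕ) :
    ∃ (V : ℕ → Set ℝ) (L : ℕ → ℕ), K ⊆ ⋃ k, V k ∧
      (∀ k, ∀ x ∈ V k, ∀ y ∈ V k, |x - y| < m / 2 ^ L k) ∧ (∀ k, T < L k) ∧
      ∀ l, ∀ F : Finset ℕ, (∀ k ∈ F, L k = l) → (F.card : ℝ) ≤ ε * (3 / 2) ^ l := by
  -- `E` bounds the sum of the square roots of the diameters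
  obtain ⟨E, hE, hET, hEε⟩ : ∃ E : ℝ, 0 < E ∧ E ^ 2 ≤ m / 2 ^ (T + 1) ∧ E ≤ ε * √(m / 2) := by
    refine ⟨min (√(m / 2 ^ (T + 1))) (ε * √(m / 2)), by positivity, ?_, min_le_right _ _⟩
    calc _ ≤ √(m / 2 ^ (T + 1)) ^ 2 := by gcongr; exact min_le_left _ _
      _ = _ := Real.sq_sqrt (by positivity)
  have hE2 : ENNReal.ofReal (E / 2) ≠ 0 := by simpa using hE
  have hzero : Measure.hausdorffMeasure (X := ℝ) (1 / 2) K = 0 := by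
    have := hausdorffMeasure_of_dimH_lt (s := K) (d := 1 / 2) (by rw [hK]; simp)
    simpa using this
  obtain ⟨V, hKV, hVsum⟩ : ∃ V : ℕ → Set ℝ, K ⊆ ⋃ k, V k ∧
      ∑' k, Metric.ediam (V k) ^ (1 / 2 : ℝ) < ENNReal.ofReal (E / 2) := by
    rw [Measure.hausdorffMeasure_apply] at hzero
    have h1 := (ENNReal.iSup_eq_zero.1 ((ENNReal.iSup_eq_zero.1 hzero) 1))
    have h1 := h1 one_pos
    have h2 := h1.trans_lt (pos_iff_ne_zero.2 hE2)
    simp only [iInf_lt_iff] at h2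
    obtain ⟨V, hV, -, h3⟩ := h2
    refine ⟨V, hV, lt_of_le_of_lt (ENNReal.tsum_le_tsum fun k => ?_) h3⟩
    rcases (V k).eq_empty_or_nonempty with h | h
    · simp [h]
    · simp [h]
  -- the sizes are made positive, so that sets with at most one point have a scale, too
  obtain ⟨η, hη, hηsum⟩ := ENNReal.exists_pos_sum_of_countable' hE2 ℕ
  set w : ℕ → ℝ≥0∞ := fun k => Metric.ediam (V k) ^ (1 / 2 : ℝ) + η k with hw
  have hwsum : ∑' k, w k < ENNReal.ofReal E := by
    rw [ENNReal.tsum_add]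
    calc _ < ENNReal.ofReal (E / 2) + ENNReal.ofReal (E / 2) := ENNReal.add_lt_add hVsum hηsum
      _ = _ := by rw [← ENNReal.ofReal_add (by positivity) (by positivity)]; ring_nf
  have hwtop : ∀ k, w k ≠ ⊤ := fun k =>
    ((ENNReal.le_tsum k).trans_lt (hwsum.trans ENNReal.ofReal_lt_top)).ne
  set s : ℕ → ℝ := fun k => (w k).toReal
  have hspos : ∀ k, 0 < s k := fun k => by
    refine ENNReal.toReal_pos ?_ (hwtop k)
    simp only [hw, ne_eq, add_eq_zero, not_and]
    exact fun _ => (hη k).ne'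
  have hssum : ∀ F : Finset ℕ, ∑ k ∈ F, s k ≤ E := by
    intro F
    rw [← ENNReal.toReal_sum fun k _ => hwtop k]
    exact ENNReal.toReal_le_of_le_ofReal hE.le ((ENNReal.sum_le_tsum F).trans hwsum.le)
  have hsE : ∀ k, s k ≤ E := fun k => by simpa using hssum {k}
  have hdiam : ∀ k, ∀ x ∈ V k, ∀ y ∈ V k, |x - y| < s k ^ 2 := by
    intro k x hx y hy
    have h1 : Metric.ediam (V k) ^ (1 / 2 : ℝ) < w k := by
      have h2 : Metric.ediam (V k) ^ (1 / 2 : ℝ) ≠ ⊤ := fun h =>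
        hwtop k (by simp only [hw, h, top_add])
      exact ENNReal.lt_add_right h2 (hη k).ne'
    have h2 : Metric.ediam (V k) < w k ^ (2 : ℝ) := by
      have h3 := ENNReal.rpow_lt_rpow h1 (two_pos (α := ℝ))
      rwa [← ENNReal.rpow_mul, show (1 / 2 : ℝ) * 2 = 1 by norm_num, ENNReal.rpow_one] at h3
    have h3 := (Metric.edist_le_ediam_of_mem hx hy).trans_lt h2
    rw [edist_dist, ← ENNReal.ofReal_toReal (hwtop k), ENNReal.ofReal_rpow_of_pos (hspos k)] at h3
    have h4 := (ENNReal.ofReal_lt_ofReal_iff_of_nonneg dist_nonneg).1 h3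
    rw [Real.dist_eq] at h4
    simpa using h4
  have hsm : ∀ k, s k ^ 2 ≤ m / 2 ^ (T + 1) := fun k =>
    le_trans (pow_le_pow_left₀ (hspos k).le (hsE k) 2) hET
  choose L hL1 hL2 using fun k => exists_dyadic_level (m := m) (u := s k ^ 2)
    (pow_pos (hspos k) 2) ((hsm k).trans (div_le_self hm.le (one_le_pow₀ one_le_two)))
  refine ⟨V, L, hKV, fun k x hx y hy => (hdiam k x hx y hy).trans_le (hL1 k), fun k => ?_, ?_⟩
  · have h1 := (hL2 k).trans_le (hsm k)
    by_contra! h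
    refine h1.not_ge ?_
    gcongr
    norm_num
  · intro l F hF
    have h1 : ∀ k ∈ F, √(m / 2 ^ (l + 1)) ≤ s k := by
      intro k hk
      have := hL2 k
      rw [hF k hk] at this
      exact Real.sqrt_le_iff.2 ⟨(hspos k).le, this.le⟩
    have h2 : F.card * √(m / 2 ^ (l + 1)) ≤ E := by
      rw [← nsmul_eq_mul]
      exact (Finset.card_nsmul_le_sum F _ _ h1).trans (hssum F)
    have h3 : √(m / 2) ≤ √(m / 2 ^ (l + 1)) * (3 / 2) ^ l := by
      refine Real.sqrt_le_iff.2 ⟨by positivity, ?_⟩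
      rw [mul_pow, Real.sq_sqrt (by positivity), ← pow_mul, mul_comm l 2, pow_mul]
      have h4 : (2 : ℝ) ^ l ≤ ((3 / 2) ^ 2) ^ l := by gcongr; norm_num
      calc m / 2 = m / 2 ^ (l + 1) * 2 ^ l := by rw [pow_succ]; field_simp
        _ ≤ _ := by gcongr
    have h4 : 0 < √(m / 2 ^ (l + 1)) := by positivity
    have h5 : F.card * √(m / 2 ^ (l + 1)) ≤ (ε * (3 / 2) ^ l) * √(m / 2 ^ (l + 1)) := by
      calc _ ≤ ε * √(m / 2) := h2.trans hEε
        _ ≤ ε * (√(m / 2 ^ (l + 1)) * (3 / 2) ^ l) := by gcongr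
        _ = _ := by ring
    exact le_of_mul_le_mul_right h5 h4

/-! ### The size of `N(τ)` -/

theorem patternBeta_pos {A D m : ℝ} (hA : 1 ≤ A) (hD : 0 < D) (hm : 0 < m) :
    0 < patternBeta A D m := by
  unfold patternBeta
  positivity

theorem rpow_one_div_eq_exp {β y : ℝ} (hβ : 0 < β) :
    β ^ (1 / y) = Real.exp (-(Real.log (1 / β) / y)) := by
  rw [Real.rpow_def_of_pos hβ, one_div β, Real.log_inv]
  ring_nf

/-- An upper bound for `n ≤ N(τ)` of the form `n ≤ const * σ / log X`, where `X = τ β` and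
`σ = τ / A`. The factor `A ^ (1 / log X)` that is missing in the definition of `N` is absorbed by
`A ≤ 1 / β` and half of the exponent. -/
theorem mul_le_of_le_patternBound {A β τ : ℝ} {n : ℕ} (hA : 1 ≤ A) (hβ : 0 < β)
    (hβA : β ≤ 1 / (4 * A)) (hX : Real.exp 1 ≤ τ * β) (hn : 1 ≤ n)
    (hnN : n ≤ patternBound A β τ) :
    (n : ℝ) * 1000000 ≤ τ * β ∧
      (n : ℝ) * 1000000 * Real.log (τ * β) * Real.exp (Real.log (1 / β) / 2)
        ≤ τ / A * Real.log (1 / β) := by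
  have he : (2.5 : ℝ) ≤ Real.exp 1 := by linarith [Real.exp_one_gt_d9]
  have hn1 : (1 : ℝ) ≤ n := by exact_mod_cast hn
  have hA0 : 0 < A := by linarith
  set X := τ * β with hXdef
  have hX0 : 0 < X := by linarith
  set y := Real.log X with hy
  have hy1 : 1 ≤ y := by
    rw [hy, Real.le_log_iff_exp_le hX0]; exact hX
  have hc0 : 0 ≤ 1 - 1 / y := by
    rw [sub_nonneg, div_le_one (by linarith)]; exact hy1
  have hAc : 1 ≤ A ^ (1 - 1 / y) := Real.one_le_rpow hA hc0
  set W := 720 ^ 2 * Real.exp 1 * A ^ (1 - 1 / y) with hW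
  have hW0 : 0 < W := by positivity
  have hpow0 : 0 < β ^ (1 / y) := by positivity
  have hnh : (n : ℝ) ≤ X / W * (1 - β ^ (1 / y)) :=
    (Nat.le_floor_iff' (by omega)).1 hnN
  have hXW : (n : ℝ) * W ≤ X * (1 - β ^ (1 / y)) := by
    rwa [div_mul_eq_mul_div, le_div_iff₀ hW0] at hnh
  have hconst : (1000000 : ℝ) ≤ 720 ^ 2 * Real.exp 1 := by linarith
  have hWlow : 1000000 ≤ W := hconst.trans (le_mul_of_one_le_right (by positivity) hAc)
  have hnX : (n : ℝ) * 1000000 ≤ X := by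
    calc (n : ℝ) * 1000000 ≤ n * W := by gcongr
      _ ≤ X * (1 - β ^ (1 / y)) := hXW
      _ ≤ X * 1 := by gcongr; linarith
      _ = X := mul_one X
  refine ⟨hnX, ?_⟩
  have hy2 : 2 ≤ y := by
    rw [hy, Real.le_log_iff_exp_le hX0]
    have : Real.exp 2 = Real.exp 1 * Real.exp 1 := by rw [← Real.exp_add]; norm_num
    rw [this]
    nlinarith [Real.exp_one_lt_d9]
  have hA4 : 4 * A * β ≤ 1 := by
    rw [le_div_iff₀ (by positivity)] at hβA; linarith
  have hAβ : A ≤ 1 / β := by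
    rw [le_div_iff₀ hβ]; nlinarith
  set x := Real.log (1 / β) with hx
  have hx0 : 0 ≤ x := Real.log_nonneg (hA.trans hAβ)
  have hexp : Real.exp x = 1 / β := Real.exp_log (by positivity)
  have hloss : 1 - β ^ (1 / y) ≤ x / y := by
    rw [rpow_one_div_eq_exp hβ]
    linarith [Real.add_one_le_exp (-(x / y))]
  have hAy : A ^ (1 / y) ≤ Real.exp (x / 2) := by
    calc A ^ (1 / y) ≤ (1 / β) ^ (1 / y) := by gcongr
      _ = Real.exp (x / y) := by
        rw [Real.rpow_def_of_pos (by positivity), ← hx, mul_one_div]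
      _ ≤ Real.exp (x / 2) := by gcongr
  have hAA : A ^ (1 - 1 / y) * A ^ (1 / y) = A := by
    rw [← Real.rpow_add hA0]; simp
  have hσX : τ / A * A = X * Real.exp x := by
    rw [hexp, hXdef]; field_simp
  have h1 : (n : ℝ) * W * y ≤ X * x := by
    calc (n : ℝ) * W * y ≤ X * (1 - β ^ (1 / y)) * y := by gcongr
      _ ≤ X * (x / y) * y := by gcongr
      _ = X * x := by field_simp
  have h2 : (n : ℝ) * 1000000 * y * A ≤ X * x * Real.exp (x / 2) := by
    calc (n : ℝ) * 1000000 * y * A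
        ≤ n * (720 ^ 2 * Real.exp 1) * y * A := by gcongr
      _ = n * W * y * A ^ (1 / y) := by rw [hW]; nth_rewrite 1 [← hAA]; ring
      _ ≤ X * x * Real.exp (x / 2) := by gcongr
  have h3 : Real.exp (x / 2) * Real.exp (x / 2) = Real.exp x := by
    rw [← Real.exp_add]; ring_nf
  have h4 : (n : ℝ) * 1000000 * y * Real.exp (x / 2) * A ≤ τ / A * x * A := by
    calc (n : ℝ) * 1000000 * y * Real.exp (x / 2) * A
        = (n : ℝ) * 1000000 * y * A * Real.exp (x / 2) := by ring
      _ ≤ X * x * Real.exp (x / 2) * Real.exp (x / 2) := by gcongr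
      _ = X * Real.exp x * x := by rw [← h3]; ring
      _ = τ / A * x * A := by rw [← hσX]; ring
  exact le_of_mul_le_mul_right h4 hA0

/-- `N(τ)` families of obstacles are few enough for the counting argument with `X = τ β`,
separation constant `τ / A` and delay `T ≈ log (τ / A) / log 2`. -/
theorem exists_delay_of_le_patternBound {A β τ : ℝ} {n : ℕ} (hA : 1 ≤ A) (hβ : 0 < β)
    (hβA : β ≤ 1 / (4 * A)) (hX : Real.exp 1 ≤ τ * β) (hn : 1 ≤ n)
    (hnN : n ≤ patternBound A β τ) :
    2 * (n : ℝ) ≤ τ * β ∧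
      ∃ T : ℕ, 4 ≤ T ∧ 48 * T * (n : ℝ) ≤ 2 ^ T ∧ 2 ^ (T + 1) ≤ τ / A := by
  obtain ⟨hnX, hmain⟩ := mul_le_of_le_patternBound hA hβ hβA hX hn hnN
  have hn1 : (1 : ℝ) ≤ n := by exact_mod_cast hn
  have hA0 : 0 < A := by linarith
  have hX0 : 0 < τ * β := (Real.exp_pos 1).trans_le hX
  refine ⟨by linarith, ?_⟩
  have hA4 : 4 * A * β ≤ 1 := by
    rw [le_div_iff₀ (by positivity)] at hβA; linarith
  have hAβ : A * β ≤ 1 := by nlinarith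
  have hτσ : τ / A = τ * β * (1 / (A * β)) := by field_simp
  have hσX : τ * β ≤ τ / A := by
    rw [hτσ]
    exact le_mul_of_one_le_right hX0.le ((one_le_div (by positivity)).2 hAβ)
  have hlogσ : Real.log (τ / A) ≤ Real.log (τ * β) + Real.log (1 / β) := by
    rw [← Real.log_mul hX0.ne' (by positivity), hτσ]
    refine Real.log_le_log (by positivity) ?_
    gcongr
    nlinarith
  have hy1 : 1 ≤ Real.log (τ * β) := (Real.le_log_iff_exp_le hX0).2 hX
  have hx0 : 0 ≤ Real.log (1 / β) :=
    Real.log_nonneg ((one_le_div hβ).2 (by nlinarith))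
  generalize Real.log (τ * β) = y at *
  generalize Real.log (1 / β) = x at *
  generalize τ / A = σ at *
  have hσ0 : 0 < σ := by linarith
  obtain ⟨N, hN1, hN2⟩ := exists_nat_pow_near (by linarith : 1 ≤ σ) (one_lt_two (α := ℝ))
  have hN : 5 ≤ N := by
    by_contra! h
    have h1 : (2 : ℝ) ^ (N + 1) ≤ 2 ^ 5 := pow_le_pow_right₀ one_le_two (by omega)
    linarith
  obtain ⟨T, rfl⟩ : ∃ T, N = T + 1 := ⟨N - 1, by omega⟩
  refine ⟨T, by omega, ?_, hN1⟩
  have hTlog : (T : ℝ) ≤ 2 * (y * (1 + x)) := by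
    have h1 : ((T + 1 : ℕ) : ℝ) * Real.log 2 ≤ Real.log σ := by
      rw [← Real.log_pow]
      exact Real.log_le_log (by positivity) hN1
    push_cast at h1
    have h2 := Real.log_two_gt_d9
    have h3 : (0 : ℝ) ≤ T := Nat.cast_nonneg T
    nlinarith
  -- `x ^ 2 = O(exp (x / 2))`, by two applications of `1 + z ≤ exp z` at `z = x / 4`
  have hx4 : 1 + x ≤ 4 * Real.exp (x / 4) := by
    linarith [Real.add_one_le_exp (x / 4)]
  have hexp4 : Real.exp (x / 4) * Real.exp (x / 4) = Real.exp (x / 2) := by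
    rw [← Real.exp_add]; ring_nf
  have hxx : (1 + x) * x ≤ 16 * Real.exp (x / 2) := by
    calc (1 + x) * x ≤ (4 * Real.exp (x / 4)) * (4 * Real.exp (x / 4)) :=
          mul_le_mul hx4 (by linarith) hx0 (by positivity)
      _ = 16 * Real.exp (x / 2) := by rw [← hexp4]; ring
  have hny : (n : ℝ) * y * (1 + x) * 1000000 ≤ 16 * σ := by
    have hle : (n : ℝ) * y * (1 + x) * 1000000 * Real.exp (x / 2)
        ≤ 16 * σ * Real.exp (x / 2) := by
      calc (n : ℝ) * y * (1 + x) * 1000000 * Real.exp (x / 2)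
          = (n * 1000000 * y * Real.exp (x / 2)) * (1 + x) := by ring
        _ ≤ σ * x * (1 + x) := mul_le_mul_of_nonneg_right hmain (by linarith)
        _ = σ * ((1 + x) * x) := by ring
        _ ≤ σ * (16 * Real.exp (x / 2)) := mul_le_mul_of_nonneg_left hxx hσ0.le
        _ = 16 * σ * Real.exp (x / 2) := by ring
    exact le_of_mul_le_mul_right hle (Real.exp_pos _)
  have h1 : 48 * (T : ℝ) * n ≤ 96 * (n * y * (1 + x)) := by
    calc 48 * (T : ℝ) * n ≤ 48 * (2 * (y * (1 + x))) * n := by gcongr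
      _ = 96 * (n * y * (1 + x)) := by ring
  have h2 : (2 : ℝ) ^ (T + 1 + 1) = 4 * 2 ^ T := by ring
  rw [h2] at hN2
  linarith

/-- The growth of `N(τ)`. The exponential `β ^ (1 / log (τ β))` tends to `1` with an error
comparable to `log (1 / β) / log τ`. -/
theorem patternBound_isTheta {A β : ℝ} (hA : 1 ≤ A) (hβ : 0 < β) (hβ1 : β < 1) :
    (fun τ : ℝ => (patternBound A β τ : ℝ)) =Θ[atTop] fun τ : ℝ => τ / Real.log τ := by
  have hA0 : 0 < A := by linarith
  set W : ℝ := 720 ^ 2 * Real.exp 1 with hW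
  have hW0 : 0 < W := by positivity
  set x := Real.log (1 / β) with hx
  have hx0 : 0 < x := Real.log_pos (one_lt_one_div hβ hβ1)
  set h : ℝ → ℝ := fun τ => τ * β / (720 ^ 2 * Real.exp 1 * A ^ (1 - 1 / Real.log (τ * β)))
    * (1 - β ^ (1 / Real.log (τ * β))) with hh
  set c : ℝ := β * x / (2 * W * A) with hc
  have hc0 : 0 < c := by positivity
  have hbounds : ∀ᶠ τ in atTop, 0 < τ ∧ 0 < Real.log τ ∧ c * (τ / Real.log τ) ≤ h τ ∧
      h τ ≤ 2 * β * x / W * (τ / Real.log τ) := by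
    filter_upwards [Real.tendsto_log_atTop.eventually_ge_atTop (2 * x + 2), eventually_gt_atTop 0]
      with τ hτ hτ0
    set l := Real.log τ with hl
    have hl0 : 0 < l := by linarith
    have hy : Real.log (τ * β) = l - x := by
      rw [Real.log_mul hτ0.ne' hβ.ne', hx, one_div, Real.log_inv]; ring
    simp only [hh]
    rw [hy]
    set y := l - x with hydef
    have hy0 : 0 < y := by linarith
    have hc0' : 0 ≤ 1 - 1 / y := by
      rw [sub_nonneg, div_le_one hy0]; linarith
    have hA1 : 1 ≤ A ^ (1 - 1 / y) := Real.one_le_rpow hA hc0'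
    have hA2 : A ^ (1 - 1 / y) ≤ A := by
      calc A ^ (1 - 1 / y) ≤ A ^ (1 : ℝ) :=
            Real.rpow_le_rpow_of_exponent_le hA (by have : 0 < 1 / y := by positivity
                                                    linarith)
        _ = A := Real.rpow_one A
    have hup : 1 - β ^ (1 / y) ≤ 2 * x / l := by
      rw [rpow_one_div_eq_exp hβ]
      have h1 : x / y ≤ 2 * x / l := by
        rw [div_le_div_iff₀ hy0 hl0]; nlinarith
      linarith [Real.add_one_le_exp (-(x / y))]
    have hlow : x / (2 * l) ≤ 1 - β ^ (1 / y) := by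
      rw [rpow_one_div_eq_exp hβ, ← hx, Real.exp_neg]
      have h1 : (Real.exp (x / y))⁻¹ ≤ (x / y + 1)⁻¹ :=
        inv_anti₀ (by positivity) (Real.add_one_le_exp _)
      have h2 : 1 - (x / y + 1)⁻¹ = x / (x + y) := by
        have : x + y ≠ 0 := by linarith
        field_simp
        ring
      have h3 : x / (2 * l) ≤ x / (x + y) := by
        gcongr
        linarith
      linarith
    have hlow0 : 0 ≤ 1 - β ^ (1 / y) := le_trans (by positivity) hlow
    refine ⟨hτ0, hl0, ?_, ?_⟩
    · calc c * (τ / l) = τ * β / (W * A) * (x / (2 * l)) := by rw [hc]; field_simp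
        _ ≤ τ * β / (W * A ^ (1 - 1 / y)) * (1 - β ^ (1 / y)) := by gcongr
    · calc τ * β / (W * A ^ (1 - 1 / y)) * (1 - β ^ (1 / y))
          ≤ τ * β / (W * 1) * (2 * x / l) := by gcongr
        _ = _ := by field_simp
  have hbig : ∀ᶠ τ in atTop, 2 ≤ c * (τ / Real.log τ) := by
    filter_upwards [Real.isLittleO_log_id_atTop.def (by positivity : 0 < c / 2), hbounds,
      eventually_gt_atTop 0] with τ h1 hτ h4
    obtain ⟨h2, h3, -, -⟩ := hτ
    rw [Real.norm_of_nonneg h3.le, id, Real.norm_of_nonneg h2.le] at h1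
    rw [← mul_div_assoc, le_div_iff₀ h3]
    linarith
  refine ⟨IsBigO.of_bound (2 * β * x / W) ?_, IsBigO.of_bound (2 / c) ?_⟩
  · filter_upwards [hbounds, hbig] with τ hτ h5
    obtain ⟨h1, h2, h3, h4⟩ := hτ
    rw [Real.norm_of_nonneg (Nat.cast_nonneg _), Real.norm_of_nonneg (by positivity)]
    have h6 : 0 ≤ h τ := by linarith
    exact (Nat.floor_le h6).trans h4
  · filter_upwards [hbounds, hbig] with τ hτ h5
    obtain ⟨h1, h2, h3, h4⟩ := hτ
    rw [Real.norm_of_nonneg (Nat.cast_nonneg _), Real.norm_of_nonneg (by positivity)]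
    have h6 : h τ < patternBound A β τ + 1 := Nat.lt_floor_add_one _
    rw [div_mul_eq_mul_div, le_div_iff₀ hc0]
    linarith

/-! ### Patterns in thick sets -/

theorem IsBiLipschitz.abs_sub_le_div {f : ℝ → ℝ} {c₁ c₂ : ℝ} (hf : IsBiLipschitz f c₁ c₂)
    (hc : 0 < c₁) (x y : ℝ) : |x - y| ≤ |f x - f y| / c₁ := by
  rw [le_div_iff₀ hc, mul_comm]
  exact (hf x y).1

/-- The case of finitely many functions and finite thickness: the preimages of the gaps of `C` are
separated obstacles in the parameter interval. -/
theorem dimH_pos_of_le_patternBound {A D m a : ℝ} (hA : 1 ≤ A) (hD : 0 < D) (hm : 0 < m)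
    {C : Set ℝ} (hC : IsCompact C) (hull : convexHull ℝ C = Icc 0 1)
    (hτ : Real.exp 1 ≤ (thickness C).toReal * patternBeta A D m)
    {F : Set (ℝ → ℝ)} [Fintype F] {c₁ c₂ : (ℝ → ℝ) → ℝ}
    (hF : ∀ f ∈ F, 0 < c₁ f ∧ IsBiLipschitz f (c₁ f) (c₂ f) ∧ c₂ f / c₁ f ≤ A ∧ (c₁ f)⁻¹ ≤ D)
    (hI : ∀ f ∈ F, ∀ t ∈ Icc a (a + m), f t ∈ Icc (0 : ℝ) 1) (hF1 : 1 ≤ Fintype.card F)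
    (hFN : Fintype.card F ≤ patternBound A (patternBeta A D m) (thickness C).toReal) :
    0 < dimH {t ∈ Icc a (a + m) | ∀ f ∈ F, f t ∈ C} := by
  set τ := (thickness C).toReal with hτdef
  set β := patternBeta A D m with hβdef
  have hA0 : 0 < A := by linarith
  have hβ : 0 < β := patternBeta_pos hA hD hm
  have hX0 : 0 < τ * β := (Real.exp_pos 1).trans_le hτ
  have hτ0 : 0 < τ := pos_of_mul_pos_left hX0 hβ.le
  obtain ⟨hC0, hC1⟩ := min_mem_max_mem_of_convexHull_eq hC hull
  have hCs : ¬ C.Subsingleton := fun h => zero_ne_one (h hC0 hC1)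
  obtain ⟨hX2, T, hT4, hnT, hTσ⟩ :=
    exists_delay_of_le_patternBound hA hβ (min_le_right _ _) hτ hF1 hFN
  have : Nonempty F := Fintype.card_pos_iff.1 hF1
  rw [pos_iff_ne_zero]
  intro hK
  set ε : ℝ := 1 / (3 * T * (3 / 2) ^ (T + 1)) with hε
  have hT0 : (0 : ℝ) < T := by exact_mod_cast (by omega : 0 < T)
  have hε0 : 0 < ε := by positivity
  obtain ⟨V, L, hV, hVd, hLT, hLε⟩ := exists_sparse_cover_of_dimH_eq_zero hK hm hε0 T
  obtain ⟨t, htI, htU, htV⟩ : ∃ t ∈ Icc a (a + m),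
      (∀ (f : F) (g : gaps C), t ∉ (f : ℝ → ℝ) ⁻¹' Ioo (g : ℝ × ℝ).1 (g : ℝ × ℝ).2) ∧
        ∀ k, t ∉ V k := by
    refine exists_mem_Icc_avoiding (ι := F) (J := gaps C) (a := a) (m := m)
      (σ := τ / A) (X := τ * β) (ε := ε) (T := T)
      (U := fun f g => (f : ℝ → ℝ) ⁻¹' Ioo (g : ℝ × ℝ).1 (g : ℝ × ℝ).2)
      (u := fun f g => ((g : ℝ × ℝ).2 - (g : ℝ × ℝ).1) / c₁ f) (V := V) (L := L) hm
      (fun f g => div_pos (sub_pos.2 g.2.1) (hF f f.2).1) ?_ ?_ ?_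
      (le_trans (by linarith [Real.exp_one_gt_d9]) hτ) hX2 hT4 hnT hTσ hVd hLT
      (mul_one_div_cancel (by positivity)).le hLε
    · rintro ⟨f, hf⟩ ⟨g, hg⟩ x hx y hy
      obtain ⟨hc, hbi, -, -⟩ := hF f hf
      refine (hbi.abs_sub_le_div hc x y).trans_lt ?_
      have h1 : |f x - f y| < g.2 - g.1 := by
        rw [abs_lt]
        constructor <;> linarith [hx.1, hx.2, hy.1, hy.2]
      exact div_lt_div_of_pos_right h1 hc
    · rintro ⟨f, hf⟩ ⟨g, hg⟩
      obtain ⟨hc, -, -, hcD⟩ := hF f hf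
      have h1 := thickness_mul_length_le_half hCs hull hg
      rw [← hτdef] at h1
      have h2 : D * β ≤ m := by
        calc D * β ≤ D * (m / D) := by gcongr; exact min_le_left _ _
          _ = m := by field_simp
      have hg0 : 0 ≤ g.2 - g.1 := sub_nonneg.2 hg.1.le
      change (g.2 - g.1) / c₁ f ≤ m / (2 * (τ * β))
      rw [le_div_iff₀ (by positivity), div_eq_mul_inv]
      calc (g.2 - g.1) * (c₁ f)⁻¹ * (2 * (τ * β))
          ≤ (g.2 - g.1) * D * (2 * (τ * β)) := by gcongr
        _ = 2 * (τ * (g.2 - g.1)) * (D * β) := by ring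
        _ ≤ 2 * (1 / 2) * m := by gcongr
        _ = m := by ring
    · rintro ⟨f, hf⟩ ⟨g, hg⟩ ⟨g', hg'⟩ hne x hx y hy
      obtain ⟨hc, hbi, hcA, -⟩ := hF f hf
      have h1 := thickness_mul_min_le_abs_sub hCs hg hg' (fun h => hne (Subtype.ext h)) hx hy
      rw [← hτdef] at h1
      have h2 := h1.trans (hbi x y).2
      rw [div_le_iff₀ hc] at hcA
      have h3 : τ * min (g.2 - g.1) (g'.2 - g'.1) ≤ A * c₁ f * |x - y| :=
        h2.trans (by gcongr)
      change τ / A * min ((g.2 - g.1) / c₁ f) ((g'.2 - g'.1) / c₁ f) ≤ |x - y|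
      rw [min_div_div_right hc.le]
      calc τ / A * (min (g.2 - g.1) (g'.2 - g'.1) / c₁ f)
          = τ * min (g.2 - g.1) (g'.2 - g'.1) / (A * c₁ f) := by field_simp
        _ ≤ |x - y| := by rw [div_le_iff₀ (by positivity)]; linarith
  have htK : t ∈ {t ∈ Icc a (a + m) | ∀ f ∈ F, f t ∈ C} := by
    refine ⟨htI, fun f hf => ?_⟩
    by_contra hfC
    obtain ⟨g, hg, hfg⟩ := exists_gap_of_notMem hC hC0 hC1 (hI f hf t htI) hfC
    exact htU ⟨f, hf⟩ ⟨g, hg⟩ hfg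
  obtain ⟨k, hk⟩ := mem_iUnion.1 (hV htK)
  exact htV k hk

theorem dimH_Icc_pos {a b : ℝ} (h : a < b) : 0 < dimH (Icc a b) := by
  rw [Real.dimH_of_nonempty_interior (by rw [interior_Icc]; exact nonempty_Ioo.2 h)]
  simp

theorem mainTheorem2 (A D m : ℝ) (hA : 1 ≤ A) (hD : 0 < D) (hm : 0 < m) :
    (∀ (F : Set (ℝ → ℝ)) (c₁ c₂ : (ℝ → ℝ) → ℝ),
      (∀ f ∈ F, 0 < c₁ f ∧ IsBiLipschitz f (c₁ f) (c₂ f) ∧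
        c₂ f / c₁ f ≤ A ∧ (c₁ f)⁻¹ ≤ D) →
      ∀ a b : ℝ, b - a = m → Icc a b ⊆ ⋂ f ∈ F, f ⁻¹' Icc 0 1 →
      ∀ C : Set ℝ, IsCompact C → convexHull ℝ C = Icc 0 1 →
      ENNReal.ofReal (Real.exp 1) ≤ thickness C * ENNReal.ofReal (patternBeta A D m) →
      ∀ F₀ ⊆ F, F₀.encard ≤ patternBoundExt A (patternBeta A D m) (thickness C) →
        0 < dimH (Icc a b ∩ ⋂ f ∈ F₀, f ⁻¹' (Iio 0 ∪ C ∪ Ioi 1)) ∧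
        ContainsPattern C (fun f : F₀ => (f : ℝ → ℝ)) ∧
        0 < dimH {t ∈ Icc a b | ∀ f ∈ F₀, f t ∈ C}) ∧
    (fun τ : ℝ => (patternBound A (patternBeta A D m) τ : ℝ))
      =Θ[atTop] (fun τ : ℝ => τ / Real.log τ) := by
  have hβ : 0 < patternBeta A D m := patternBeta_pos hA hD hm
  refine ⟨?_, patternBound_isTheta hA hβ ?_⟩
  · intro F c₁ c₂ hF a b hab hI C hC hull hτ F₀ hF₀ hcard
    obtain rfl : b = a + m := by linarith
    have hIC : ∀ f ∈ F₀, ∀ t ∈ Icc a (a + m), f t ∈ Icc (0 : ℝ) 1 := fun f hf t ht =>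
      mem_iInter₂.1 (hI ht) f (hF₀ hf)
    have key : 0 < dimH {t ∈ Icc a (a + m) | ∀ f ∈ F₀, f t ∈ C} := by
      -- the trivial case comprises empty `F₀` and infinite thickness
      by_cases htriv : ∀ f ∈ F₀, ∀ t ∈ Icc a (a + m), f t ∈ C
      · rw [show {t ∈ Icc a (a + m) | ∀ f ∈ F₀, f t ∈ C} = Icc a (a + m) from
          subset_antisymm (fun t ht => ht.1) fun t ht => ⟨ht, fun f hf => htriv f hf t ht⟩]
        exact dimH_Icc_pos (by linarith)
      · have htop : thickness C ≠ ⊤ := by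
          intro h
          obtain ⟨hC0, hC1⟩ := min_mem_max_mem_of_convexHull_eq hC hull
          refine htriv fun f hf t ht => ?_
          by_contra hft
          obtain ⟨g, hg, -⟩ := exists_gap_of_notMem hC hC0 hC1 (hIC f hf t ht) hft
          rw [gaps_eq_empty_of_thickness_eq_top hull h] at hg
          exact hg
        rw [patternBoundExt, if_neg htop] at hcard
        have hfin : F₀.Finite := finite_of_encard_le_coe hcard
        have : Fintype F₀ := hfin.fintype
        have hcard' : Fintype.card F₀ ≤
            patternBound A (patternBeta A D m) (thickness C).toReal := by
          rw [← Set.coe_fintypeCard] at hcard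
          exact_mod_cast hcard
        refine dimH_pos_of_le_patternBound hA hD hm hC hull ?_ (fun f hf => hF f (hF₀ hf)) hIC ?_
          hcard'
        · have h1 := ENNReal.toReal_mono (ENNReal.mul_ne_top htop ENNReal.ofReal_ne_top) hτ
          rwa [ENNReal.toReal_mul, ENNReal.toReal_ofReal (Real.exp_pos 1).le,
            ENNReal.toReal_ofReal hβ.le] at h1
        · push Not at htriv
          obtain ⟨f, hf, -⟩ := htriv
          exact Fintype.card_pos_iff.2 ⟨⟨f, hf⟩⟩
    refine ⟨?_, ?_, key⟩
    · refine key.trans_le (dimH_mono ?_)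
      rintro t ⟨htI, ht⟩
      exact ⟨htI, mem_iInter₂.2 fun f hf => Or.inl (Or.inr (ht f hf))⟩
    · have hne : {t ∈ Icc a (a + m) | ∀ f ∈ F₀, f t ∈ C}.Nonempty := by
        rw [nonempty_iff_ne_empty]
        intro h
        rw [h, dimH_empty] at key
        exact lt_irrefl _ key
      obtain ⟨t, -, ht⟩ := hne
      exact ⟨t, fun f => ht f f.2⟩
  · refine (min_le_right _ _).trans_lt ?_
    rw [div_lt_one (by positivity)]
    linarith
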